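/- Conventions. Let $k$ be a field of characteristic $0$ and let $\mathcal E$ be a category with finite products (for instance a topos). All spaces are objects of $\mathcal E$, and statements about their elements are read in $\mathcal E$ through generalized elements (morphisms $T\to M$, for an arbitrary stage $T$; quantifiers range over all later stages). Let $R$ be a commutative $k$-algebra object of $\mathcal E$ satisfying the general Kock–Lawvere axiom: for every Weil algebra $W$ over $k$ (a finite-dimensional commutative local $k$-algebra with residue field $k$), the canonical map $R\otimes_k W\to R^{\operatorname{Spec}_R W}$ is a bijection, where $\operatorname{Spec}_R W=\operatorname{Hom}_{k\text{-alg}}(W,R)$. Put $D=\{d\in R\mid d^2=0\}$. A space $M$ is microlinear if the functor $W\mapsto M^{\operatorname{Spec}_R W}$ sends every finite limit diagram of $k$-algebras consisting of Weil algebras to a limit diagram. A Lie group is a group object $G$ which is microlinear as a space. Its Lie algebra $\mathfrak g$ is the space of all $X:D\to G$ with $X(0)=1$, with $(X+Y)(d)=X(d)\,Y(d)$ and $(rX)(d)=X(rd)$ for $r\in R$, and with $[X,Y]$ the unique element of $\mathfrak g$ such that $[X,Y](d_1d_2)=X(d_1)\,Y(d_2)\,X(d_1)^{-1}\,Y(d_2)^{-1}$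 for all $d_1,d_2\in D$. The Lie group $G$ is regular if for every $\xi:R\to\mathfrak g$ there is a unique $\varphi:R\to G$ with $\varphi(0)=1$ and $\varphi(r+d)=\xi(r)(d)\,\varphi(r)$ for all $r\in R$, $d\in D$. In this case $\exp:\mathfrak g\to G$ is defined by $\exp X=\varphi(1)$, where $\varphi$ belongs to the constant curve $\xi=X$. Theorem 4.2. Let $G$ be a regular Lie group with Lie algebra $\mathfrak g$. Let $d_1,d_2\in D$ and $X_1,X_2,Y_1,Y_2\in\mathfrak g$, and put $\delta=d_1+d_2$. Then $$\exp\!\left(\delta X_1+\tfrac12\delta^2X_2\right)\cdot\exp\!\left(\delta Y_1+\tfrac12\delta^2Y_2\right)=\exp\!\left(\delta(X_1+Y_1)+\tfrac12\delta^2\left(X_2+Y_2+[X_1,Y_1]\right)\right).$$ -/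

import Mathlib

open CategoryTheory MonoidalCategory CartesianMonoidalCategory Opposite
open scoped MonObj CommRingObj DualNumber TensorProduct

universe w v u w₁ w₂

/-!
# Synthetic Lie groups

The ambient "world of spaces" is a category `E` with finite products, for instance a topos.  The
line is a commutative ring object `R` of `E` which is an algebra over a field `k`.

Statements of synthetic differential geometry built from `∀`, `∃!` and `=` are read in `E` through
generalized elements (Kripke-Joyal semantics): an element of a space `M` at stage `T` is a morphism
`T ⟶ M`, it can be restricted along every `S ⟶ T`, and "for all" means for all elements at all
later stages.  Function spaces and spaces of the form `Spec_R W` are described by their generalized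
elements; when `E` has the corresponding object (as every topos does) that object represents them,
by the Yoneda lemma.
-/

namespace SDG

section Functions

variable {E : Type u} [Category.{v} E]

/-- The elements at stage `T` of the function space `Y ^ X`: a function defined on all elements of
`X` at all later stages, compatible with restriction.  Equivalently, a natural transformation from
`Hom(-, T) × X` to `Y`. -/
@[ext]
structure Fn (T : E) (X : Eᵒᵖ ⥤ Type w₁) (Y : Eᵒᵖ ⥤ Type w₂) where
  toFun : ∀ {S : E}, (S ⟶ T) → X.obj (op S) → Y.obj (op S)
  naturality : ∀ {S S' : E} (q : S' ⟶ S) (p : S ⟶ T) (x : X.obj (op S)),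
    toFun (q ≫ p) (X.map q.op x) = Y.map q.op (toFun p x)

namespace Fn

variable {T : E} {X : Eᵒᵖ ⥤ Type w₁} {Y : Eᵒᵖ ⥤ Type w₂}

/-- Restriction of a function at stage `T` to a later stage. -/
def restrict {T' : E} (f : Fn T X Y) (q : T' ⟶ T) : Fn T' X Y where
  toFun p x := f.toFun (p ≫ q) x
  naturality r p x := by
    rw [Category.assoc]
    exact f.naturality r (p ≫ q) x

/-- The constant function with value `y`. -/
def const (X : Eᵒᵖ ⥤ Type w₁) (y : Y.obj (op T)) : Fn T X Y where
  toFun p _ := Y.map p.op y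
  naturality q p _ := by simp

end Fn

/-- The value at `x : X` (at stage `S`) of a function from `X` to the space `M`. -/
def Fn.app {T : E} {X : Eᵒᵖ ⥤ Type w₁} {M : E} (f : Fn T X (yoneda.obj M)) {S : E} (p : S ⟶ T)
    (x : X.obj (op S)) : S ⟶ M :=
  f.toFun p x

theorem Fn.app_congr {T : E} {X : Eᵒᵖ ⥤ Type w₁} {M : E} {f g : Fn T X (yoneda.obj M)}
    (h : f = g) {S : E} (p : S ⟶ T) (x : X.obj (op S)) : f.app p x = g.app p x := by rw [h]

end Functions

variable {E : Type u} [Category.{v} E] [CartesianMonoidalCategory E] [BraidedCategory E]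

/-- A `k`-algebra structure on the ring object `R`: a ring homomorphism from `k` to the ring of
global elements of `R`. -/
class AlgebraObj (k : Type w) [Field k] (R : E) [CommRingObj R] where
  scalar : k →+* (𝟙_ E ⟶ R)

section Line

variable (k : Type w) [Field k] (R : E) [CommRingObj R] [AlgebraObj k R]

/-- Restriction of generalized elements of `R`, as a ring homomorphism. -/
def restrictRingHom {S T : E} (p : S ⟶ T) : (T ⟶ R) →+* (S ⟶ R) where
  toFun a := p ≫ a
  map_one' := MonObj.comp_one p
  map_mul' a b := MonObj.comp_mul p a b
  map_zero' := AddMonObj.comp_zero p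
  map_add' a b := AddMonObj.comp_add p a b

/-- The ring of elements of `R` at stage `T` is a `k`-algebra, through global elements. -/
instance algebraHom (T : E) : Algebra k (T ⟶ R) :=
  ((restrictRingHom R (toUnit T)).comp (AlgebraObj.scalar (k := k) (R := R))).toAlgebra

/-- Restriction of generalized elements of `R`, as a homomorphism of `k`-algebras. -/
def restrictAlgHom {S T : E} (p : S ⟶ T) : (T ⟶ R) →ₐ[k] (S ⟶ R) :=
  { restrictRingHom R p with
    commutes' := fun c => by
      change p ≫ (toUnit T ≫ AlgebraObj.scalar c) = toUnit S ≫ AlgebraObj.scalar c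
      rw [← Category.assoc]
      congr 1
      exact toUnit_unique _ _ }

/-- The space of first order infinitesimals `D = {d ∈ R | d² = 0}`. -/
def D : Eᵒᵖ ⥤ Type v where
  obj T := {d : T.unop ⟶ R // d ^ 2 = 0}
  map q := ↾ fun d => ⟨q.unop ≫ d.1, by
    have h := congrArg (restrictRingHom R q.unop) d.2
    rw [map_pow, map_zero] at h
    exact h⟩
  map_id T := by ext d; simp
  map_comp p q := by ext d; simp

/-- The element `0` of `D`. -/
def D.zero (T : E) : (D R).obj (op T) := ⟨(0 : T ⟶ R), by simp⟩

/-- The product `r d` of `r ∈ R` and `d ∈ D`, an element of `D`. -/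
def D.smul {T : E} (r : T ⟶ R) (d : (D R).obj (op T)) : (D R).obj (op T) :=
  ⟨r * d.1, by rw [mul_pow, d.2, mul_zero]⟩

end Line

section Weil

/-- A Weil algebra over `k`: a finite-dimensional commutative `k`-algebra which is local with
residue field `k` (and hence, being finite-dimensional, has a nilpotent maximal ideal). -/
structure WeilAlgebra (k : Type w) [Field k] where
  carrier : Type w
  [commRing : CommRing carrier]
  [algebra : Algebra k carrier]
  [finite : Module.Finite k carrier]
  augmentation : carrier →ₐ[k] k
  nilpotent : ∀ x, augmentation x = 0 → IsNilpotent x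

attribute [instance] WeilAlgebra.commRing WeilAlgebra.algebra WeilAlgebra.finite

instance (k : Type w) [Field k] : CoeSort (WeilAlgebra k) (Type w) := ⟨WeilAlgebra.carrier⟩

variable (k : Type w) [Field k] (R : E) [CommRingObj R] [AlgebraObj k R]

/-- The infinitesimal space `Spec_R W` of a Weil algebra `W`: its elements at stage `T` are the
`k`-algebra homomorphisms from `W` to the algebra of elements of `R` at stage `T`.  For
`W = k[x₁, …, xₙ] / (f₁, …, fₘ)` this is `{(r₁, …, rₙ) ∈ Rⁿ | f₁(r) = ⋯ = fₘ(r) = 0}`. -/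
def spec (W : WeilAlgebra k) : Eᵒᵖ ⥤ Type (max w v) where
  obj T := W →ₐ[k] (T.unop ⟶ R)
  map q := ↾ fun x => (restrictAlgHom k R q.unop).comp x
  map_id T := ConcreteCategory.hom_ext _ _ fun x =>
    AlgHom.ext fun a => Category.id_comp (DFunLike.coe (F := W →ₐ[k] (T.unop ⟶ R)) x a)
  map_comp {T _ _} p q := ConcreteCategory.hom_ext _ _ fun x =>
    AlgHom.ext fun a => Category.assoc q.unop p.unop (DFunLike.coe (F := W →ₐ[k] (T.unop ⟶ R)) x a)

/-- The comparison map `R ⊗ W → R ^ (Spec_R W)`, `r ⊗ a ↦ (x ↦ r * x(a))`, at stage `T`. -/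
def comparison (W : WeilAlgebra k) (T : E) (a : (T ⟶ R) ⊗[k] W) :
    Fn T (spec k R W) (yoneda.obj R) where
  toFun p x := Algebra.TensorProduct.productMap (restrictAlgHom k R p) x a
  naturality {S S'} q p x := by
    have key : ∀ y : W →ₐ[k] (S ⟶ R),
        Algebra.TensorProduct.productMap (restrictAlgHom k R (q ≫ p)) ((restrictAlgHom k R q).comp y) =
          (restrictAlgHom k R q).comp
            (Algebra.TensorProduct.productMap (restrictAlgHom k R p) y) := fun y => by
      refine Algebra.TensorProduct.ext' fun r b => ?_
      rw [AlgHom.comp_apply, Algebra.TensorProduct.productMap_apply_tmul,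
        Algebra.TensorProduct.productMap_apply_tmul, map_mul]
      exact congrArg (· * restrictAlgHom k R q (y b)) (Category.assoc q p r)
    exact DFunLike.congr_fun (key x) a

/-- The general Kock-Lawvere axiom for the `k`-algebra object `R`: for every Weil algebra `W` over
`k`, the comparison map `R ⊗ W → R ^ (Spec_R W)` is a bijection. -/
class KockLawvere : Prop where
  bijective : ∀ (W : WeilAlgebra k) (T : E), Function.Bijective (comparison k R W T)

/-- The map `M ^ (Spec_R W) → M ^ (Spec_R W')` induced by a homomorphism `h : W → W'`, by
composition with `Spec_R W' → Spec_R W`. -/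
def prolong {W W' : WeilAlgebra k} (h : W →ₐ[k] W') {T : E} {Y : Eᵒᵖ ⥤ Type w₂}
    (f : Fn T (spec k R W) Y) : Fn T (spec k R W') Y where
  toFun p x := f.toFun p (AlgHom.comp x h)
  naturality q p x := f.naturality q p (AlgHom.comp x h)

/-- `X₀`, with the maps `π j`, is the limit of the diagram of sets `X j` whose arrows are the maps
`g a : X (src a) → X (tgt a)`. -/
def IsLimitCone {J A : Type} (src tgt : A → J) {X : J → Type w₁}
    (g : ∀ a, X (src a) → X (tgt a)) {X₀ : Type w₁} (π : ∀ j, X₀ → X j) : Prop :=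
  (∀ a x, g a (π (src a) x) = π (tgt a) x) ∧
    ∀ x : ∀ j, X j, (∀ a, g a (x (src a)) = x (tgt a)) → ∃! x₀, ∀ j, π j x₀ = x j

/-- The space `M` is microlinear: for every finite diagram of Weil algebras with a cone that is a
limit of `k`-algebras (equivalently, of sets), and whose vertex is a Weil algebra, the functor
`W ↦ M ^ (Spec_R W)` turns it into a limit.  In other words, `M` perceives every finite
quasi-colimit of infinitesimal spaces as a colimit. -/
class Microlinear (M : E) : Prop where
  isLimitCone : ∀ {J A : Type} [Finite J] [Finite A] (src tgt : A → J) (W : J → WeilAlgebra k)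
    (g : ∀ a, W (src a) →ₐ[k] W (tgt a)) (W₀ : WeilAlgebra k) (π : ∀ j, W₀ →ₐ[k] W j),
    IsLimitCone src tgt (X := fun j => W j) (fun a => g a) (fun j => π j) →
      ∀ T : E, IsLimitCone src tgt (X := fun j => Fn T (spec k R (W j)) (yoneda.obj M))
        (fun a => prolong k R (g a)) (fun j => prolong k R (π j))

end Weil

section LieAlgebra

variable (R : E) [CommRingObj R] (G : E) [GrpObj G]

/-- The Lie algebra of `G`: its elements at stage `T` are the tangent vectors to `G` at the unit
element, that is, the functions `X` from `D` to `G` with `X(0) = 1`. -/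
@[ext]
structure LieAlg (T : E) where
  toFn : Fn T (D R) (yoneda.obj G)
  map_zero : ∀ {S : E} (p : S ⟶ T), toFn.app p (D.zero R S) = 1

variable {R G}

namespace LieAlg

/-- Restriction of a tangent vector to a later stage. -/
def restrict {T T' : E} (X : LieAlg R G T) (q : T' ⟶ T) : LieAlg R G T' where
  toFn := X.toFn.restrict q
  map_zero p := X.map_zero (p ≫ q)

theorem restrict_id {T : E} (X : LieAlg R G T) : X.restrict (𝟙 T) = X := by
  refine LieAlg.ext (Fn.ext ?_)
  funext S p d
  change X.toFn.toFun (p ≫ 𝟙 T) d = X.toFn.toFun p d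
  rw [Category.comp_id]

theorem restrict_comp {T T' T'' : E} (X : LieAlg R G T) (q : T' ⟶ T) (r : T'' ⟶ T') :
    X.restrict (r ≫ q) = (X.restrict q).restrict r := by
  refine LieAlg.ext (Fn.ext ?_)
  funext S p d
  change X.toFn.toFun (p ≫ r ≫ q) d = X.toFn.toFun ((p ≫ r) ≫ q) d
  rw [Category.assoc]

/-- The value `X(d)` of a tangent vector. -/
def app {T : E} (X : LieAlg R G T) {S : E} (p : S ⟶ T) (d : (D R).obj (op S)) : S ⟶ G :=
  X.toFn.app p d

theorem app_naturality {T : E} (X : LieAlg R G T) {S S' : E} (q : S' ⟶ S) (p : S ⟶ T)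
    (d : (D R).obj (op S)) : X.app (q ≫ p) ((D R).map q.op d) = q ≫ X.app p d :=
  X.toFn.naturality q p d

/-- The sum of tangent vectors at the unit element, `(X + Y)(d) = X(d) Y(d)`.  This is the usual
sum `d ↦ ℓ(d, d)` of tangent vectors, where `ℓ` is the function `(d₁, d₂) ↦ X(d₁) Y(d₂)` on
`D(2) = {(d₁, d₂) | d₁² = d₂² = d₁ d₂ = 0}`, which restricts to `X` and to `Y` on the axes. -/
instance (T : E) : Add (LieAlg R G T) where
  add X Y :=
    { toFn :=
        { toFun := fun p d => X.app p d * Y.app p d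
          naturality := fun q p d => by
            rw [app_naturality, app_naturality]
            exact (MonObj.comp_mul q _ _).symm }
      map_zero := fun p => by
        change X.app p _ * Y.app p _ = 1
        rw [app, app, X.map_zero, Y.map_zero, mul_one] }

/-- Scalar multiplication of tangent vectors, `(r X)(d) = X(r d)`. -/
instance (T : E) : SMul (T ⟶ R) (LieAlg R G T) where
  smul r X :=
    { toFn :=
        { toFun := fun p d => X.app p (D.smul R (p ≫ r) d)
          naturality := fun q p d => by
            refine Eq.trans ?_ (X.app_naturality q p (D.smul R (p ≫ r) d))
            congr 1
            refine Subtype.ext ?_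
            change ((q ≫ p) ≫ r) * (q ≫ d.1) = q ≫ ((p ≫ r) * d.1)
            rw [MonObj.comp_mul, Category.assoc] }
      map_zero := fun {S} p => by
        refine Eq.trans ?_ (X.map_zero p)
        change X.app p _ = X.app p _
        congr 1
        exact Subtype.ext (mul_zero (p ≫ r)) }

/-- The commutator `X(d₁) Y(d₂) X(d₁)⁻¹ Y(d₂)⁻¹` in `G`. -/
def commutator {T : E} (X Y : LieAlg R G T) {S : E} (p : S ⟶ T) (d₁ d₂ : (D R).obj (op S)) :
    S ⟶ G :=
  X.app p d₁ * Y.app p d₂ * (X.app p d₁)⁻¹ * (Y.app p d₂)⁻¹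

theorem commutator_naturality {T : E} (X Y : LieAlg R G T) {S S' : E} (q : S' ⟶ S) (p : S ⟶ T)
    (d₁ d₂ : (D R).obj (op S)) :
    X.commutator Y (q ≫ p) ((D R).map q.op d₁) ((D R).map q.op d₂) =
      q ≫ X.commutator Y p d₁ d₂ := by
  simp only [commutator, app_naturality, MonObj.comp_mul, GrpObj.comp_inv]

/-- `Z` is the Lie bracket of `X` and `Y`: for all `d₁, d₂ ∈ D`, `Z(d₁ d₂)` is the commutator
`X(d₁) Y(d₂) X(d₁)⁻¹ Y(d₂)⁻¹`. -/
def IsBracket {T : E} (X Y Z : LieAlg R G T) : Prop :=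
  ∀ {S : E} (p : S ⟶ T) (d₁ d₂ : (D R).obj (op S)),
    Z.app p (D.smul R d₁.1 d₂) = X.commutator Y p d₁ d₂

end LieAlg

variable (R G)

/-- The Lie algebra of `G` as a space. -/
def lieAlg : Eᵒᵖ ⥤ Type (max u v) where
  obj T := LieAlg R G T.unop
  map q := ↾ fun X => X.restrict q.unop
  map_id T := ConcreteCategory.hom_ext _ _ fun (X : LieAlg R G T.unop) => X.restrict_id
  map_comp {T _ _} q r := ConcreteCategory.hom_ext _ _ fun (X : LieAlg R G T.unop) =>
    X.restrict_comp q.unop r.unop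

variable {R G}

/-- `φ : R → G` is the evolution of the curve `ξ : R → 𝔤`: it starts at `φ(0) = 1` and has right
logarithmic derivative `ξ`, that is, `φ(r + d) = ξ(r)(d) φ(r)` for all `r ∈ R` and `d ∈ D`. -/
def IsEvolution {T : E} (ξ : Fn T (yoneda.obj R) (lieAlg R G))
    (φ : Fn T (yoneda.obj R) (yoneda.obj G)) : Prop :=
  (∀ {S : E} (p : S ⟶ T), φ.app p (0 : S ⟶ R) = 1) ∧
    ∀ {S : E} (p : S ⟶ T) (r : S ⟶ R) (d : (D R).obj (op S)),
      φ.app p (r + d.1) = LieAlg.app (ξ.toFun p r) (𝟙 S) d * φ.app p r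

variable (R G) in
/-- The group `G` is regular: every curve in its Lie algebra has a unique evolution in `G`. -/
class IsRegular : Prop where
  existsUnique : ∀ (T : E) (ξ : Fn T (yoneda.obj R) (lieAlg R G)),
    ∃! φ : Fn T (yoneda.obj R) (yoneda.obj G), IsEvolution ξ φ

/-- The exponential map of a regular group: `exp X = φ(1)`, where `φ` is the evolution of the
constant curve `X`. -/
noncomputable def exp [IsRegular R G] {T : E} (X : LieAlg R G T) : T ⟶ G :=
  (IsRegular.existsUnique (R := R) (G := G) T
    (Fn.const (yoneda.obj R) (Y := lieAlg R G) X)).choose.app (𝟙 T) (1 : T ⟶ R)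

end LieAlgebra

section Bracket

/-! The Lie bracket exists and is unique: `G` perceives the multiplication `D × D → D` as the
quotient of `D × D` in which the two axes are collapsed to a point. -/

open TrivSqZeroExt

variable (k : Type w) [Field k]

/-- The homomorphism `k[ε] → A` with `ε ↦ e`, where `e² = 0`. -/
def hom₁ {A : Type w₁} [CommRing A] [Algebra k A] (e : A) (he : e * e = 0) : k[ε] →ₐ[k] A :=
  DualNumber.lift ⟨(Algebra.ofId k A, e), he, fun _ => Commute.all _ _⟩

/-- The homomorphism `k[ε₁, ε₂] → A` with `ε₁ ↦ e₁`, `ε₂ ↦ e₂`, where `e₁² = e₂² = 0`. -/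
def hom₂ {A : Type w₁} [CommRing A] [Algebra k A] (e₁ e₂ : A) (h₁ : e₁ * e₁ = 0)
    (h₂ : e₂ * e₂ = 0) : k[ε][ε] →ₐ[k] A :=
  DualNumber.lift ⟨(hom₁ k e₁ h₁, e₂), h₂, fun _ => Commute.all _ _⟩

variable {k}

theorem hom₁_apply {A : Type w₁} [CommRing A] [Algebra k A] (e : A) (he : e * e = 0) (x : k[ε]) :
    hom₁ k e he x = algebraMap k A x.fst + algebraMap k A x.snd * e := rfl

theorem hom₂_apply {A : Type w₁} [CommRing A] [Algebra k A] (e₁ e₂ : A) (h₁ : e₁ * e₁ = 0)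
    (h₂ : e₂ * e₂ = 0) (x : k[ε][ε]) :
    hom₂ k e₁ e₂ h₁ h₂ x = (algebraMap k A x.fst.fst + algebraMap k A x.fst.snd * e₁) +
      (algebraMap k A x.snd.fst + algebraMap k A x.snd.snd * e₁) * e₂ := rfl

variable (k)

/-- The Weil algebra `k[ε]`, whose spectrum is `D`. -/
def weil₁ : WeilAlgebra k where
  carrier := k[ε]
  finite := inferInstanceAs (Module.Finite k (k × k))
  augmentation := fstHom k k k
  nilpotent x hx := ⟨2, by
    have h : x.fst = 0 := hx
    ext <;> simp [pow_two, h]⟩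

/-- The Weil algebra `k[ε₁, ε₂]`, whose spectrum is `D × D`. -/
def weil₂ : WeilAlgebra k where
  carrier := k[ε][ε]
  finite := inferInstanceAs (Module.Finite k ((k × k) × (k × k)))
  augmentation := (fstHom k k k).comp (fstHom k k[ε] k[ε])
  nilpotent x hx := ⟨3, by
    have h : x.fst.fst = 0 := hx
    ext <;> simp [pow_succ, h]⟩

/-- The homomorphism `ε ↦ ε₁ ε₂`, dual to the multiplication `D × D → D`. -/
def mulHom : k[ε] →ₐ[k] k[ε][ε] :=
  hom₁ k (A := k[ε][ε]) (inl DualNumber.eps * DualNumber.eps) (by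
    refine TrivSqZeroExt.ext ?_ ?_ <;> simp)

/-- The homomorphism `ε ↦ 0`, dual to the constant function `0 : D → D`. -/
def zeroHom : k[ε] →ₐ[k] k[ε] := hom₁ k 0 (mul_zero 0)

/-- The homomorphisms dual to the functions `d ↦ (0, 0)`, `d ↦ (d, 0)`, `d ↦ (0, d)`. -/
def axisHom : Fin 3 → (k[ε][ε] →ₐ[k] k[ε])
  | 0 => hom₂ k 0 0 (mul_zero 0) (mul_zero 0)
  | 1 => hom₂ k DualNumber.eps 0 DualNumber.eps_mul_eps (mul_zero 0)
  | 2 => hom₂ k 0 DualNumber.eps (mul_zero 0) DualNumber.eps_mul_eps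

/-- The diagram `k[ε₁, ε₂] ⇶ k[ε]`. -/
def diag : Bool → WeilAlgebra k
  | false => weil₂ k
  | true => weil₁ k

/-- The cone over this diagram with vertex `k[ε]`. -/
def coneHom : ∀ j, weil₁ k →ₐ[k] diag k j
  | false => mulHom k
  | true => zeroHom k

theorem algebraMap_dual (c : k) : algebraMap k k[ε] c = inl c := rfl

theorem algebraMap_dual₂ (c : k) : algebraMap k k[ε][ε] c = inl (inl c) := rfl

theorem axisHom_comp_mulHom (a : Fin 3) : (axisHom k a).comp (mulHom k) = zeroHom k := by
  refine DualNumber.algHom_ext ?_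
  fin_cases a <;> ext <;> simp [axisHom, mulHom, zeroHom, hom₁_apply, hom₂_apply,
    algebraMap_dual, algebraMap_dual₂]

theorem existsUnique_mulHom (y : k[ε][ε]) (z : k[ε]) (h : ∀ a, axisHom k a y = z) :
    ∃! x : k[ε], mulHom k x = y ∧ zeroHom k x = z := by
  have h0 := h 0
  have h1 := (h 1).trans h0.symm
  have h2 := (h 2).trans h0.symm
  simp [axisHom, hom₂_apply, algebraMap_dual, TrivSqZeroExt.ext_iff] at h0 h1 h2
  refine ⟨inl y.fst.fst + inr y.snd.snd, ⟨?_, ?_⟩, fun x hx => ?_⟩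
  · refine TrivSqZeroExt.ext (TrivSqZeroExt.ext ?_ ?_) (TrivSqZeroExt.ext ?_ ?_) <;>
      simp [mulHom, hom₁_apply, algebraMap_dual₂, h1, h2]
  · rw [← h 0]
    refine TrivSqZeroExt.ext ?_ ?_ <;>
      simp [zeroHom, axisHom, hom₁_apply, hom₂_apply, algebraMap_dual]
  · obtain ⟨rfl, -⟩ := hx
    refine TrivSqZeroExt.ext ?_ ?_ <;> simp [mulHom, hom₁_apply, algebraMap_dual₂]

theorem isLimitCone_mul :
    IsLimitCone (J := Bool) (A := Fin 3) (fun _ => false) (fun _ => true) (X := fun j => diag k j)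
      (fun a => axisHom k a) (fun j => coneHom k j) := by
  refine ⟨fun a x => DFunLike.congr_fun (axisHom_comp_mulHom k a) x, fun x hx => ?_⟩
  obtain ⟨x₀, ⟨h₁, h₂⟩, h₃⟩ := existsUnique_mulHom k (x false) (x true) hx
  exact ⟨x₀, fun j => match j with
    | false => h₁
    | true => h₂, fun x' h' => h₃ x' ⟨h' false, h' true⟩⟩

variable {R : E} [CommRingObj R] [AlgebraObj k R] {G : E} [GrpObj G]

/-- The element of `D` given by an element of square zero in a `k`-algebra and a homomorphism. -/
def toD {A : Type w₁} [Semiring A] [Algebra k A] (e : A) (he : e * e = 0) {S : E}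
    (x : A →ₐ[k] (S ⟶ R)) : (D R).obj (op S) :=
  ⟨x e, by rw [pow_two, ← map_mul, he, map_zero]⟩

theorem sq_zero {S : E} (d : (D R).obj (op S)) : d.1 * d.1 = 0 := (pow_two d.1).symm.trans d.2

theorem eps₁_sq : (inl DualNumber.eps : k[ε][ε]) * inl DualNumber.eps = 0 := by
  rw [← inl_mul, DualNumber.eps_mul_eps, inl_zero]

theorem eps₂_sq : (DualNumber.eps : k[ε][ε]) * DualNumber.eps = 0 := DualNumber.eps_mul_eps

/-- The function `(d₁, d₂) ↦ X(d₁) Y(d₂) X(d₁)⁻¹ Y(d₂)⁻¹` on `D × D`. -/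
def commutatorFn {T : E} (X Y : LieAlg R G T) : Fn T (spec k R (weil₂ k)) (yoneda.obj G) where
  toFun p x := X.commutator Y p (toD k _ (eps₁_sq k) x) (toD k _ (eps₂_sq k) x)
  naturality q p x :=
    X.commutator_naturality Y q p (toD k _ (eps₁_sq k) x) (toD k _ (eps₂_sq k) x)

/-- A tangent vector as a function on the spectrum of `k[ε]`. -/
def LieAlg.toSpec {T : E} (Z : LieAlg R G T) : Fn T (spec k R (weil₁ k)) (yoneda.obj G) where
  toFun p x := Z.app p (toD k _ DualNumber.eps_mul_eps x)
  naturality q p x := Z.app_naturality q p (toD k _ DualNumber.eps_mul_eps x)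

/-- The constant function `1`. -/
def oneFn (T : E) : Fn T (spec k R (weil₁ k)) (yoneda.obj G) where
  toFun {S} _ _ := (1 : S ⟶ G)
  naturality q _ _ := (MonObj.comp_one q).symm

theorem LieAlg.app_eq_one {T : E} (X : LieAlg R G T) {S : E} (p : S ⟶ T) (d : (D R).obj (op S))
    (h : d.1 = 0) : X.app p d = 1 := by
  have : d = D.zero R S := Subtype.ext h
  rw [this]
  exact X.map_zero p

theorem axisHom_eps (a : Fin 3) :
    axisHom k a (inl DualNumber.eps) = 0 ∨ axisHom k a DualNumber.eps = 0 := by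
  fin_cases a <;> simp [axisHom, hom₂_apply, algebraMap_dual, TrivSqZeroExt.ext_iff]

theorem commutator_axis {T : E} (X Y : LieAlg R G T) (a : Fin 3) {S : E} (p : S ⟶ T)
    (x : k[ε] →ₐ[k] (S ⟶ R)) :
    X.commutator Y p (toD k _ (eps₁_sq k) (x.comp (axisHom k a)))
      (toD k _ (eps₂_sq k) (x.comp (axisHom k a))) = 1 := by
  have hx : ∀ e : k[ε][ε], axisHom k a e = 0 → x.comp (axisHom k a) e = 0 := fun e he => by
    rw [AlgHom.comp_apply, he, map_zero]
  rw [LieAlg.commutator]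
  rcases axisHom_eps k a with h | h
  · rw [LieAlg.app_eq_one X p _ (hx _ h), one_mul, inv_one, mul_one, mul_inv_cancel]
  · rw [LieAlg.app_eq_one Y p _ (hx _ h), mul_one, inv_one, mul_one, mul_inv_cancel]

theorem prolong_commutatorFn {T : E} (X Y : LieAlg R G T) (a : Fin 3) :
    prolong k R (W := weil₂ k) (W' := weil₁ k) (axisHom k a) (commutatorFn k X Y) =
      oneFn k T := by
  refine Fn.ext ?_
  funext S p x
  exact commutator_axis k X Y a p x

theorem mulHom_eps : mulHom k DualNumber.eps = inl DualNumber.eps * DualNumber.eps := by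
  refine TrivSqZeroExt.ext (TrivSqZeroExt.ext ?_ ?_) (TrivSqZeroExt.ext ?_ ?_) <;>
    simp [mulHom, hom₁_apply, algebraMap_dual₂]

theorem toD_mulHom {S : E} (x : k[ε][ε] →ₐ[k] (S ⟶ R)) :
    toD k _ DualNumber.eps_mul_eps (x.comp (mulHom k)) =
      D.smul R (toD k _ (eps₁_sq k) x).1 (toD k _ (eps₂_sq k) x) := by
  refine Subtype.ext ?_
  change x (mulHom k DualNumber.eps) = x (inl DualNumber.eps) * x DualNumber.eps
  rw [mulHom_eps, map_mul]

theorem hom₁_eps {S : E} (d : (D R).obj (op S)) :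
    toD k _ DualNumber.eps_mul_eps (hom₁ k d.1 (sq_zero d)) = d := by
  refine Subtype.ext ?_
  change hom₁ k d.1 (sq_zero d) DualNumber.eps = d.1
  rw [hom₁_apply, DualNumber.fst_eps, DualNumber.snd_eps, map_zero, map_one, zero_add, one_mul]

theorem hom₁_toD {S : E} (x : k[ε] →ₐ[k] (S ⟶ R)) (h) :
    hom₁ k (toD k _ DualNumber.eps_mul_eps x).1 h = x :=
  DualNumber.algHom_ext (congrArg Subtype.val (hom₁_eps k (toD k _ DualNumber.eps_mul_eps x)))

theorem hom₂_eps₁ {S : E} (d₁ d₂ : (D R).obj (op S)) :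
    toD k _ (eps₁_sq k) (hom₂ k d₁.1 d₂.1 (sq_zero d₁) (sq_zero d₂)) = d₁ := by
  refine Subtype.ext ?_
  change hom₂ k d₁.1 d₂.1 (sq_zero d₁) (sq_zero d₂) (inl DualNumber.eps) = d₁.1
  simp [hom₂_apply]

theorem hom₂_eps₂ {S : E} (d₁ d₂ : (D R).obj (op S)) :
    toD k _ (eps₂_sq k) (hom₂ k d₁.1 d₂.1 (sq_zero d₁) (sq_zero d₂)) = d₂ := by
  refine Subtype.ext ?_
  change hom₂ k d₁.1 d₂.1 (sq_zero d₁) (sq_zero d₂) DualNumber.eps = d₂.1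
  simp [hom₂_apply]

theorem isBracket_iff {T : E} (X Y Z : LieAlg R G T) :
    X.IsBracket Y Z ↔
      prolong k R (W := weil₁ k) (W' := weil₂ k) (mulHom k) (Z.toSpec k) = commutatorFn k X Y := by
  constructor
  · intro h
    refine Fn.ext ?_
    funext S p x
    exact (congrArg (Z.app p) (toD_mulHom k x)).trans (h p _ _)
  · intro h S p d₁ d₂
    have h' : Z.app p (toD k _ DualNumber.eps_mul_eps
        ((hom₂ k d₁.1 d₂.1 (sq_zero d₁) (sq_zero d₂)).comp (mulHom k))) =
          X.commutator Y p (toD k _ (eps₁_sq k) (hom₂ k d₁.1 d₂.1 (sq_zero d₁) (sq_zero d₂)))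
            (toD k _ (eps₂_sq k) (hom₂ k d₁.1 d₂.1 (sq_zero d₁) (sq_zero d₂))) :=
      Fn.app_congr h p (hom₂ k d₁.1 d₂.1 (sq_zero d₁) (sq_zero d₂))
    rwa [toD_mulHom, hom₂_eps₁, hom₂_eps₂] at h'

theorem prolong_zeroHom {T : E} (Z : LieAlg R G T) :
    prolong k R (W := weil₁ k) (W' := weil₁ k) (zeroHom k) (Z.toSpec k) = oneFn k T := by
  refine Fn.ext ?_
  funext S p x
  refine Z.app_eq_one p _ ?_
  change DFunLike.coe (F := k[ε] →ₐ[k] (S ⟶ R)) x (zeroHom k DualNumber.eps) = 0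
  have h : zeroHom k DualNumber.eps = 0 := by simp [zeroHom, hom₁_apply]
  rw [h]
  exact map_zero (show k[ε] →ₐ[k] (S ⟶ R) from x)

/-- The tangent vector given by a function on the spectrum of `k[ε]`. -/
def ofSpec {T : E} (φ : Fn T (spec k R (weil₁ k)) (yoneda.obj G))
    (h : prolong k R (W := weil₁ k) (W' := weil₁ k) (zeroHom k) φ = oneFn k T) :
    LieAlg R G T where
  toFn :=
    { toFun := fun p d => φ.app p (hom₁ k d.1 (sq_zero d))
      naturality := fun {S S'} q p d => by
        refine Eq.trans ?_ (φ.naturality q p (hom₁ k d.1 (sq_zero d)))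
        refine congrArg (φ.app (q ≫ p)) ?_
        refine DualNumber.algHom_ext (A := (S' ⟶ R)) ?_
        have h₁ := congrArg Subtype.val (hom₁_eps k ((D R).map q.op d))
        have h₂ := congrArg (fun e => q ≫ e) (congrArg Subtype.val (hom₁_eps k d))
        exact h₁.trans h₂.symm }
  map_zero := fun {S} p => by
    have h' := Fn.app_congr h p (hom₁ k (0 : S ⟶ R) (mul_zero 0))
    refine Eq.trans ?_ h'
    refine congrArg (φ.app p) ?_
    refine DualNumber.algHom_ext (A := (S ⟶ R)) ?_
    change hom₁ k (0 : S ⟶ R) (mul_zero 0) DualNumber.eps =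
      hom₁ k (0 : S ⟶ R) (mul_zero 0) (zeroHom k DualNumber.eps)
    simp [zeroHom, hom₁_apply]

theorem toSpec_ofSpec {T : E} (φ : Fn T (spec k R (weil₁ k)) (yoneda.obj G)) (h) :
    (ofSpec k φ h).toSpec k = φ := by
  refine Fn.ext ?_
  funext S p x
  exact congrArg (φ.app p) (hom₁_toD k x _)

theorem toSpec_injective {T : E} {Z Z' : LieAlg R G T} (h : Z.toSpec k = Z'.toSpec k) : Z = Z' := by
  refine LieAlg.ext (Fn.ext ?_)
  funext S p d
  have h' : Z.app p (toD k _ DualNumber.eps_mul_eps (hom₁ k d.1 (sq_zero d))) =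
      Z'.app p (toD k _ DualNumber.eps_mul_eps (hom₁ k d.1 (sq_zero d))) :=
    Fn.app_congr h p (hom₁ k d.1 (sq_zero d))
  rwa [hom₁_eps] at h'

theorem existsUnique_isBracket [Microlinear k R G] {T : E} (X Y : LieAlg R G T) :
    ∃! Z : LieAlg R G T, X.IsBracket Y Z := by
  obtain ⟨φ, hφ, hu⟩ := (Microlinear.isLimitCone (k := k) (R := R) (M := G) (fun _ => false)
    (fun _ => true) (diag k) (axisHom k) (weil₁ k) (coneHom k) (isLimitCone_mul k) T).2
      (fun j => match j with
        | false => commutatorFn k X Y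
        | true => oneFn k T) (prolong_commutatorFn k X Y)
  refine ⟨ofSpec k φ (hφ true), ?_, fun Z hZ => ?_⟩
  · refine (isBracket_iff k X Y _).2 ?_
    exact (congrArg (prolong k R (W := weil₁ k) (W' := weil₂ k) (mulHom k))
      (toSpec_ofSpec k φ _)).trans (hφ false)
  · refine toSpec_injective k ((hu (Z.toSpec k) fun j => ?_).trans (toSpec_ofSpec k φ _).symm)
    match j with
    | false => exact (isBracket_iff k X Y Z).1 hZ
    | true => exact prolong_zeroHom k Z

/-- The Lie bracket of two tangent vectors at the unit element. -/
noncomputable def bracket [Microlinear k R G] {T : E} (X Y : LieAlg R G T) : LieAlg R G T :=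
  (existsUnique_isBracket k X Y).choose

end Bracket

end SDG

/-!
Write `δ = d₁ + d₂`, so that `δ² / 2 = d₁ d₂`.  The proof computes the exponential of
`δ X + d₁ d₂ Z` in closed form: it is `X(d₂) X(d₁) Z(d₁ d₂)` (`exp_add_smul`).  The identity is then
a computation in the group `Hom(T, G)`: the values at `d₁ d₂` commute with each other and with the
values at `d₁` and `d₂`, so reordering costs something only when `X₁(d₁)` passes `Y₁(d₂)`,
and the defect there is `[X₁, Y₁](d₁ d₂)` by definition of the bracket.

For the closed form, let `φ` be the evolution of the constant curve `X` (`LieAlg.flow`).  It extends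
`X` from `D` to `R`, so that `φ(d + d') = X(d') X(d)` for all `d, d' ∈ D`; in particular `X` is
additive on pairs with `d d' = 0`.  The curve `r ↦ φ(r δ) Z(r d₁ d₂)` is an evolution of
`δ X + d₁ d₂ Z`: the required commutation of `φ(r δ) = X(r d₂) X(r d₁)` with the
increments `Z(d d₁ d₂)` holds because `X(a)` and `Z(b)` commute as soon as `a b = 0`, their
commutator being `[X, Z](a b)`.  Uniqueness of evolutions finishes the computation.
-/

namespace SDG

variable {E : Type u} [Category.{v} E] [CartesianMonoidalCategory E] [BraidedCategory E]
  {R : E} [CommRingObj R] {G : E} [GrpObj G]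

namespace LieAlg

theorem app_add {T S : E} (X Y : LieAlg R G T) (p : S ⟶ T) (d : (D R).obj (op S)) :
    (X + Y).app p d = X.app p d * Y.app p d := rfl

theorem app_restrict {T T' S : E} (X : LieAlg R G T) (q : T' ⟶ T) (p : S ⟶ T')
    (d : (D R).obj (op S)) : (X.restrict q).app p d = X.app (p ≫ q) d := rfl

theorem bracket_app (k : Type w) [Field k] [AlgebraObj k R] [Microlinear k R G]
    {T S : E} (X Y : LieAlg R G T) (p : S ⟶ T) (d₁ d₂ : (D R).obj (op S)) :
    (bracket k X Y).app p (D.smul R d₁.1 d₂) = X.commutator Y p d₁ d₂ :=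
  (existsUnique_isBracket k X Y).choose_spec.1 p d₁ d₂

/-- The bracket is the defect of commutation, written as a left factor. -/
theorem app_mul_app (k : Type w) [Field k] [AlgebraObj k R] [Microlinear k R G]
    {T S : E} (X Y : LieAlg R G T) (p : S ⟶ T) (d₁ d₂ : (D R).obj (op S)) :
    X.app p d₁ * Y.app p d₂ =
      (bracket k X Y).app p (D.smul R d₁.1 d₂) * (Y.app p d₂ * X.app p d₁) := by
  rw [bracket_app, commutator]
  group

theorem commute_app (k : Type w) [Field k] [AlgebraObj k R] [Microlinear k R G]
    {T S : E} (X Y : LieAlg R G T) (p : S ⟶ T) (d₁ d₂ : (D R).obj (op S))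
    (h : d₁.1 * d₂.1 = 0) : Commute (X.app p d₁) (Y.app p d₂) := by
  have := X.app_mul_app k Y p d₁ d₂
  rwa [app_eq_one (bracket k X Y) p _ h, one_mul] at this

theorem isEvolution_const_iff {T : E} (X : LieAlg R G T)
    (φ : Fn T (yoneda.obj R) (yoneda.obj G)) :
    IsEvolution (Fn.const (yoneda.obj R) (Y := lieAlg R G) X) φ ↔
      (∀ {S : E} (p : S ⟶ T), φ.app p (0 : S ⟶ R) = 1) ∧
        ∀ {S : E} (p : S ⟶ T) (r : S ⟶ R) (d : (D R).obj (op S)),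
          φ.app p (r + d.1) = X.app p d * φ.app p r := by
  have h : ∀ {S : E} (p : S ⟶ T) (r : S ⟶ R) (d : (D R).obj (op S)),
      LieAlg.app ((Fn.const (yoneda.obj R) (Y := lieAlg R G) X).toFun p r) (𝟙 S) d =
        X.app p d := fun {S} p r d =>
    (X.app_restrict p (𝟙 S) d).trans (by rw [Category.id_comp])
  refine and_congr_right fun _ => ?_
  constructor
  · intro H S p r d
    exact (H p r d).trans (congrArg (· * φ.app p r) (h p r d))
  · intro H S p r d
    exact (H p r d).trans (congrArg (· * φ.app p r) (h p r d).symm)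

variable [IsRegular R G]

/-- The one-parameter subgroup of `G` with initial velocity `X`: the evolution `R → G` of the
constant curve `X`. -/
noncomputable def flow {T : E} (X : LieAlg R G T) : Fn T (yoneda.obj R) (yoneda.obj G) :=
  (IsRegular.existsUnique (R := R) (G := G) T
    (Fn.const (yoneda.obj R) (Y := lieAlg R G) X)).choose

theorem isEvolution_flow {T : E} (X : LieAlg R G T) :
    IsEvolution (Fn.const (yoneda.obj R) (Y := lieAlg R G) X) X.flow :=
  (IsRegular.existsUnique (R := R) (G := G) T
    (Fn.const (yoneda.obj R) (Y := lieAlg R G) X)).choose_spec.1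

theorem flow_naturality {T S S' : E} (X : LieAlg R G T) (q : S' ⟶ S) (p : S ⟶ T) (r : S ⟶ R) :
    X.flow.app (q ≫ p) (q ≫ r) = q ≫ X.flow.app p r :=
  X.flow.naturality q p r

theorem flow_zero {T S : E} (X : LieAlg R G T) (p : S ⟶ T) : X.flow.app p (0 : S ⟶ R) = 1 :=
  X.isEvolution_flow.1 p

theorem flow_add {T S : E} (X : LieAlg R G T) (p : S ⟶ T) (r : S ⟶ R) (d : (D R).obj (op S)) :
    X.flow.app p (r + d.1) = X.app p d * X.flow.app p r :=
  ((isEvolution_const_iff X X.flow).1 X.isEvolution_flow).2 p r d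

theorem flow_coe {T S : E} (X : LieAlg R G T) (p : S ⟶ T) (d : (D R).obj (op S)) :
    X.flow.app p d.1 = X.app p d := by
  have h := X.flow_add p 0 d
  rwa [flow_zero, mul_one, zero_add] at h

theorem flow_coe_add_coe {T S : E} (X : LieAlg R G T) (p : S ⟶ T) (d₁ d₂ : (D R).obj (op S)) :
    X.flow.app p (d₁.1 + d₂.1) = X.app p d₂ * X.app p d₁ := by
  rw [flow_add, flow_coe]

/-- Tangent vectors are additive on the pairs of elements of `D` whose sum is in `D`. -/
theorem app_eq_mul_of_add {T S : E} (X : LieAlg R G T) (p : S ⟶ T)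
    {d d₁ d₂ : (D R).obj (op S)} (h : d.1 = d₁.1 + d₂.1) :
    X.app p d = X.app p d₂ * X.app p d₁ := by
  rw [← flow_coe, h, flow_coe_add_coe]

end LieAlg

variable [IsRegular R G]

theorem exp_eq_of_isEvolution {T : E} {X : LieAlg R G T}
    {φ : Fn T (yoneda.obj R) (yoneda.obj G)}
    (h : IsEvolution (Fn.const (yoneda.obj R) (Y := lieAlg R G) X) φ) :
    exp X = φ.app (𝟙 T) (1 : T ⟶ R) :=
  Fn.app_congr ((IsRegular.existsUnique (R := R) (G := G) T
    (Fn.const (yoneda.obj R) (Y := lieAlg R G) X)).unique X.isEvolution_flow h) _ _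

/-- The curve `r ↦ φ(r δ) Z(r e)`, where `φ` is the one-parameter subgroup of `X`. -/
noncomputable def flowMulApp {T : E} (X Z : LieAlg R G T) (δ : T ⟶ R) (e : (D R).obj (op T)) :
    Fn T (yoneda.obj R) (yoneda.obj G) where
  toFun {S} p := fun (r : S ⟶ R) =>
    X.flow.app p (r * (p ≫ δ)) * Z.app p (D.smul R r ((D R).map p.op e))
  naturality {S S'} q p := fun (r : S ⟶ R) => by
    have h₁ : (q ≫ r) * ((q ≫ p) ≫ δ) = q ≫ (r * (p ≫ δ)) := by
      rw [MonObj.comp_mul, Category.assoc]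
    have h₂ : D.smul R (q ≫ r) ((D R).map (q ≫ p).op e) =
        (D R).map q.op (D.smul R r ((D R).map p.op e)) := by
      refine Subtype.ext ?_
      change (q ≫ r) * ((q ≫ p) ≫ e.1) = q ≫ (r * (p ≫ e.1))
      rw [MonObj.comp_mul, Category.assoc]
    change X.flow.app (q ≫ p) ((q ≫ r) * ((q ≫ p) ≫ δ)) *
      Z.app (q ≫ p) (D.smul R (q ≫ r) ((D R).map (q ≫ p).op e)) =
        q ≫ (X.flow.app p (r * (p ≫ δ)) * Z.app p (D.smul R r ((D R).map p.op e)))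
    rw [h₁, h₂, LieAlg.app_naturality, LieAlg.flow_naturality]
    exact (MonObj.comp_mul q _ _).symm

/-- The closed form of the exponential: in terms of `δ = d₁ + d₂` this is
`exp(δ X + (δ² / 2) Z) = X(d₂) X(d₁) Z(δ² / 2)`. -/
theorem exp_add_smul (k : Type w) [Field k] [AlgebraObj k R] [Microlinear k R G] {T : E}
    (X Z : LieAlg R G T) (d₁ d₂ : (D R).obj (op T)) :
    exp ((d₁.1 + d₂.1) • X + (d₁.1 * d₂.1) • Z) =
      X.app (𝟙 T) d₂ * X.app (𝟙 T) d₁ * Z.app (𝟙 T) (D.smul R d₁.1 d₂) := by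
  have h : IsEvolution (Fn.const (yoneda.obj R) (Y := lieAlg R G)
      ((d₁.1 + d₂.1) • X + (d₁.1 * d₂.1) • Z))
      (flowMulApp X Z (d₁.1 + d₂.1) (D.smul R d₁.1 d₂)) := by
    refine (LieAlg.isEvolution_const_iff _ _).2 ⟨fun {S} p => ?_, fun {S} p r d => ?_⟩
    · change X.flow.app p ((0 : S ⟶ R) * (p ≫ (d₁.1 + d₂.1))) *
        Z.app p (D.smul R (0 : S ⟶ R) ((D R).map p.op (D.smul R d₁.1 d₂))) = 1
      rw [zero_mul, LieAlg.flow_zero, LieAlg.app_eq_one Z p _ (zero_mul _), mul_one]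
    · set a : (D R).obj (op S) := (D R).map p.op d₁
      set b : (D R).obj (op S) := (D R).map p.op d₂
      set e : (D R).obj (op S) := (D R).map p.op (D.smul R d₁.1 d₂)
      have hδ : p ≫ (d₁.1 + d₂.1) = a.1 + b.1 := AddMonObj.comp_add p _ _
      have hab : p ≫ (d₁.1 * d₂.1) = a.1 * b.1 := MonObj.comp_mul p _ _
      have hea : e.1 = a.1 * b.1 := hab
      have hflow : X.flow.app p (r * (a.1 + b.1)) =
          X.app p (D.smul R r b) * X.app p (D.smul R r a) := by
        rw [mul_add]
        exact X.flow_coe_add_coe p (D.smul R r a) (D.smul R r b)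
      -- The evolution at `r δ` moves by the increment `d δ`, an element of `D`.
      have h₁ : X.flow.app p ((r + d.1) * (a.1 + b.1)) =
          X.app p (D.smul R (a.1 + b.1) d) * X.flow.app p (r * (a.1 + b.1)) := by
        rw [← LieAlg.flow_add]
        refine congrArg (X.flow.app p) ?_
        change (r + d.1) * (a.1 + b.1) = r * (a.1 + b.1) + (a.1 + b.1) * d.1
        ring
      have h₂ : Z.app p (D.smul R (r + d.1) e) =
          Z.app p (D.smul R (a.1 * b.1) d) * Z.app p (D.smul R r e) := by
        refine Z.app_eq_mul_of_add p ?_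
        change (r + d.1) * e.1 = r * e.1 + a.1 * b.1 * d.1
        rw [hea]
        ring
      have hcomm : Commute (X.flow.app p (r * (a.1 + b.1)))
          (Z.app p (D.smul R (a.1 * b.1) d)) := by
        rw [hflow]
        refine Commute.mul_left (X.commute_app k Z p _ _ ?_) (X.commute_app k Z p _ _ ?_)
        · change r * b.1 * (a.1 * b.1 * d.1) = 0
          linear_combination (r * a.1 * d.1) * sq_zero b
        · change r * a.1 * (a.1 * b.1 * d.1) = 0
          linear_combination (r * b.1 * d.1) * sq_zero a
      change X.flow.app p ((r + d.1) * (p ≫ (d₁.1 + d₂.1))) * Z.app p (D.smul R (r + d.1) e) =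
        X.app p (D.smul R (p ≫ (d₁.1 + d₂.1)) d) * Z.app p (D.smul R (p ≫ (d₁.1 * d₂.1)) d) *
          (X.flow.app p (r * (p ≫ (d₁.1 + d₂.1))) * Z.app p (D.smul R r e))
      rw [hδ, hab, h₁, h₂, mul_assoc, mul_assoc, ← mul_assoc (X.flow.app p _), hcomm.eq, mul_assoc]
  rw [exp_eq_of_isEvolution h]
  have h₁ : (1 : T ⟶ R) * (𝟙 T ≫ (d₁.1 + d₂.1)) = d₁.1 + d₂.1 := by
    rw [Category.id_comp, one_mul]
  have h₂ : D.smul R (1 : T ⟶ R) ((D R).map (𝟙 T).op (D.smul R d₁.1 d₂)) =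
      D.smul R d₁.1 d₂ := by
    refine Subtype.ext ?_
    change (1 : T ⟶ R) * (𝟙 T ≫ (d₁.1 * d₂.1)) = d₁.1 * d₂.1
    rw [Category.id_comp, one_mul]
  change X.flow.app (𝟙 T) ((1 : T ⟶ R) * (𝟙 T ≫ (d₁.1 + d₂.1))) *
    Z.app (𝟙 T) (D.smul R (1 : T ⟶ R) ((D R).map (𝟙 T).op (D.smul R d₁.1 d₂))) = _
  rw [h₁, h₂, LieAlg.flow_coe_add_coe]

end SDG

theorem theorem4p2 {k : Type w} [Field k] [CharZero k]
    {E : Type u} [Category.{v} E] [CartesianMonoidalCategory E] [BraidedCategory E]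
    (R : E) [CommRingObj R] [SDG.AlgebraObj k R] [SDG.KockLawvere k R]
    (G : E) [GrpObj G] [SDG.Microlinear k R G] [SDG.IsRegular R G]
    {T : E} (d₁ d₂ : T ⟶ R) (hd₁ : d₁ ^ 2 = 0) (hd₂ : d₂ ^ 2 = 0)
    (X₁ X₂ Y₁ Y₂ : SDG.LieAlg R G T) :
    let δ : T ⟶ R := d₁ + d₂
    SDG.exp (δ • X₁ + ((1 / 2 : k) • δ ^ 2) • X₂) * SDG.exp (δ • Y₁ + ((1 / 2 : k) • δ ^ 2) • Y₂) =
      SDG.exp (δ • (X₁ + Y₁) + ((1 / 2 : k) • δ ^ 2) • (X₂ + Y₂ + SDG.bracket k X₁ Y₁)) := by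
  intro δ
  have hδ : (1 / 2 : k) • δ ^ 2 = d₁ * d₂ := by
    have h : δ ^ 2 = (2 : k) • (d₁ * d₂) := by
      rw [two_smul]
      linear_combination hd₁ + hd₂
    rw [h, smul_smul, one_div, inv_mul_cancel₀ two_ne_zero, one_smul]
  rw [hδ]
  let a : (SDG.D R).obj (op T) := ⟨d₁, hd₁⟩
  let b : (SDG.D R).obj (op T) := ⟨d₂, hd₂⟩
  let e : (SDG.D R).obj (op T) := SDG.D.smul R d₁ b
  have hexp (X Z : SDG.LieAlg R G T) : SDG.exp (δ • X + (d₁ * d₂) • Z) =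
      X.app (𝟙 T) b * X.app (𝟙 T) a * Z.app (𝟙 T) e := SDG.exp_add_smul k X Z a b
  rw [hexp, hexp, hexp]
  simp only [SDG.LieAlg.app_add]
  have hae : a.1 * e.1 = 0 := by
    change d₁ * (d₁ * d₂) = 0
    linear_combination d₂ * hd₁
  have hbe : b.1 * e.1 = 0 := by
    change d₂ * (d₁ * d₂) = 0
    linear_combination d₁ * hd₂
  have hbr := X₁.app_mul_app k Y₁ (𝟙 T) a b
  have he : SDG.D.smul R a.1 b = e := rfl
  rw [he] at hbr
  have cX₁ := X₂.commute_app k Y₁ (𝟙 T) e b ((mul_comm _ _).trans hbe)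
  have cX₂ := X₂.commute_app k Y₁ (𝟙 T) e a ((mul_comm _ _).trans hae)
  have cX₃ := (SDG.bracket k X₁ Y₁).commute_app k Y₁ (𝟙 T) e a ((mul_comm _ _).trans hae)
  have cX₄ := (SDG.bracket k X₁ Y₁).commute_app k Y₁ (𝟙 T) e b ((mul_comm _ _).trans hbe)
  have cX₅ := (SDG.bracket k X₁ Y₁).commute_app k X₁ (𝟙 T) e a ((mul_comm _ _).trans hae)
  have ce := (X₂ + Y₂).commute_app k (SDG.bracket k X₁ Y₁) (𝟙 T) e e (by
    change d₁ * d₂ * (d₁ * d₂) = 0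
    linear_combination d₂ ^ 2 * hd₁)
  rw [SDG.LieAlg.app_add] at ce
  generalize X₁.app (𝟙 T) a = xa at *
  generalize X₁.app (𝟙 T) b = xb at *
  generalize Y₁.app (𝟙 T) a = ya at *
  generalize Y₁.app (𝟙 T) b = yb at *
  generalize X₂.app (𝟙 T) e = x at *
  generalize Y₂.app (𝟙 T) e = y at *
  generalize (SDG.bracket k X₁ Y₁).app (𝟙 T) e = z at *
  -- The exchange of `xa` and `yb` in the second step produces the bracket term `z`.
  calc xb * xa * x * (yb * ya * y) = xb * (xa * yb) * ya * x * y := by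
        rw [mul_assoc _ x, ← mul_assoc x, (cX₁.mul_right cX₂).eq]
        simp only [mul_assoc]
    _ = xb * yb * (xa * ya) * z * x * y := by
        rw [hbr, ((cX₄.mul_right cX₅)).eq, mul_assoc xb, mul_assoc _ z, cX₃.eq]
        simp only [mul_assoc]
    _ = xb * yb * (xa * ya) * (x * y * z) := by
        rw [ce.eq]
        simp only [mul_assoc]
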